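/- Let $n\ge 3$ and let $P_1,\dots,P_n,F$ be points of the Euclidean plane, no three of which are collinear. Let $\varepsilon_1,\dots,\varepsilon_n$ be independent random variables with values in $(-\pi,\pi]$, and for each $i$ let $R_i$ be the random open ray starting at $P_i$ (with $P_i\notin R_i$) that makes the signed angle $\varepsilon_i$ with the ray from $P_i$ through $F$. Assume that $$\mathrm{Prob}(\varepsilon_i<0)=\mathrm{Prob}(\varepsilon_i>0)=\tfrac12\quad\text{for every } i,$$ and that $$\mathrm{Prob}(R_i\cap R_j=\emptyset)=0\quad\text{for all } i\ne j.$$ Let $L_i$ be the line containing $R_i$, and let $U$ be the (random) union of the unbounded connected components of the complement of $L_1\cup\dots\cup L_n$ in the plane. Then $\{F\in U\}$ is an event and $$\mathrm{Prob}(F\in U)=\frac{2n}{2^n}.$$ -/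

import Mathlib

namespace CockedHat

/-- The direction obtained from that of the ray `P → F` by rotating it by the signed angle `ε`
(counterclockwise for `ε > 0`). The Euclidean plane is `ℂ`. -/
noncomputable def direction (P F : ℂ) (ε : ℝ) : ℂ :=
  Complex.exp (ε * Complex.I) * (F - P)

/-- The ray from `P` that makes the signed angle `ε` with the ray `P → F`.
Its starting point `P` does not belong to it. -/
def ray (P F : ℂ) (ε : ℝ) : Set ℂ :=
  {z | ∃ t : ℝ, 0 < t ∧ z = P + t * direction P F ε}

/-- The line that contains `ray P F ε`. -/
def lineOfRay (P F : ℂ) (ε : ℝ) : Set ℂ :=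
  {z | ∃ t : ℝ, z = P + t * direction P F ε}

/-- The union of the unbounded connected components of the complement of the lines `L i`. -/
def unboundedRegion {ι : Type*} (L : ι → Set ℂ) : Set ℂ :=
  ⋃₀ {C | ∃ x ∈ (⋃ i, L i)ᶜ, C = connectedComponentIn (⋃ i, L i)ᶜ x ∧ ¬ Bornology.IsBounded C}

/-- No three points (with distinct indices) of the family are collinear. -/
def GeneralPosition {ι : Type*} (Q : ι → ℂ) : Prop :=
  ∀ i j k, i ≠ j → i ≠ k → j ≠ k → ¬ Collinear ℝ {Q i, Q j, Q k}

end CockedHat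

/-! The point `F` lies in an unbounded cell exactly when no line passes through `F` and some
half-line from `F` never crosses a line. If the lines are oriented so that `F` lies on the same side
of all of them, this says that their directions lie in a closed half-plane, i.e. that one of the
directions comes first counterclockwise.

If two rays meet, the sense in which the second turns from the first is determined by the side of
the line joining their origins to which they point, and hence by either of the two angles alone; as
the angles are independent, it is almost surely constant. The degenerate cases, in which both rays
lie on the line joining their origins or one of them points away from `F`, would force one of the
angles to have an almost surely constant sign. Hence the rays almost surely form a deterministic
tournament.

Orienting the lines reverses the rays with negative angle, so the tournament is switched by
independent fair signs. For each `i`, exactly two of the `2 ^ n` patterns of signs make `i` precede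
all others, and no pattern does so for two indices; this gives `2 * n / 2 ^ n`.
-/

open MeasureTheory ProbabilityTheory Filter Topology

namespace CockedHat

section Hyperplanes

variable {ι E : Type*}

section TopologicalVectorSpace

variable [AddCommGroup E] [Module ℝ E] [TopologicalSpace E]

/-- The open cell containing `x` of the arrangement of hyperplanes `{z | ℓ i z = c i}`: the points
lying strictly on the same side as `x` of each of them. -/
def cell (ℓ : ι → StrongDual ℝ E) (c : ι → ℝ) (x : E) : Set E :=
  {z | ∀ i, 0 < (ℓ i x - c i) * (ℓ i z - c i)}

variable {ℓ : ι → StrongDual ℝ E} {c : ι → ℝ} {x : E}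

theorem convex_cell : Convex ℝ (cell ℓ c x) := by
  simp only [cell, mul_sub, sub_pos, Set.ofPred_forall]
  exact convex_iInter fun i ↦ convex_halfSpace_gt ((ℓ i x - c i) • ℓ i).isLinear _

variable [IsTopologicalAddGroup E] [ContinuousSMul ℝ E]

theorem connectedComponentIn_compl_hyperplanes (hx : ∀ i, ℓ i x ≠ c i) :
    connectedComponentIn {z | ∀ i, ℓ i z ≠ c i} x = cell ℓ c x := by
  have hx' : ∀ i, ℓ i x - c i ≠ 0 := fun i ↦ sub_ne_zero.2 (hx i)
  refine Set.Subset.antisymm (fun z hz i ↦ ?_) <|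
    convex_cell.isPreconnected.subset_connectedComponentIn
      (fun i ↦ mul_self_pos.2 (hx' i)) fun z hz i hi ↦ ?_
  · by_contra! hle
    have hcont : Continuous fun w ↦ (ℓ i x - c i) * (ℓ i w - c i) := by fun_prop
    obtain ⟨w, hw, hw0⟩ := isPreconnected_connectedComponentIn.intermediate_value hz
      (mem_connectedComponentIn hx) hcont.continuousOn ⟨hle, mul_self_nonneg _⟩
    exact mul_ne_zero (hx' i) (sub_ne_zero.2 (connectedComponentIn_subset _ _ hw i)) hw0
  · simpa [hi] using hz i

theorem mem_asymptoticCone_cell_iff (hx : ∀ i, ℓ i x ≠ c i) {v : E} :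
    v ∈ asymptoticCone ℝ (cell ℓ c x) ↔ ∀ i, 0 ≤ (ℓ i x - c i) * ℓ i v := by
  constructor
  · intro hv i
    set a := ℓ i x - c i with ha
    have hhalf : cell ℓ c x ⊆ {z | a * c i ≤ (a • ℓ i) z} := fun z hz ↦ by
      simpa [mul_sub] using (hz i).le
    have hray : ∀ t : ℝ, 0 ≤ t → 0 ≤ a ^ 2 + t * (a * ℓ i v) := fun t ht ↦ by
      have hmem := (convex_halfSpace_ge (a • ℓ i).isLinear
        (a * c i)).smul_vadd_mem_of_isClosed_of_mem_asymptoticCone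
          (isClosed_le continuous_const (a • ℓ i).continuous) ht (asymptoticCone_mono hhalf hv)
          (hhalf fun j ↦ mul_self_pos.2 (sub_ne_zero.2 (hx j)))
      have hle : a * c i ≤ a * (t * ℓ i v + ℓ i x) := by simpa using hmem
      linear_combination hle - a * ha
    by_contra! hneg
    have h := hray ((a ^ 2 + 1) / -(a * ℓ i v))
      (div_nonneg (by positivity) (neg_nonneg.2 hneg.le))
    rw [div_neg, neg_mul, div_mul_cancel₀ _ hneg.ne] at h
    linarith
  · intro hv
    refine ((tendsto_id.atTop_smul_const_tendsto_asymptoticNhds v).asymptoticNhds_vadd_const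
      x).frequently (Eventually.frequently ?_)
    filter_upwards [eventually_ge_atTop 0] with t ht i
    have hpos : 0 < (ℓ i x - c i) * (ℓ i x - c i) := mul_self_pos.2 (sub_ne_zero.2 (hx i))
    simp only [id, vadd_eq_add, map_add, map_smul, smul_eq_mul]
    linarith [mul_nonneg ht (hv i)]

end TopologicalVectorSpace

theorem not_isBounded_connectedComponentIn_compl_hyperplanes_iff [NormedAddCommGroup E]
    [NormedSpace ℝ E] [FiniteDimensional ℝ E] {ℓ : ι → StrongDual ℝ E} {c : ι → ℝ} {x : E}
    (hx : ∀ i, ℓ i x ≠ c i) :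
    ¬ Bornology.IsBounded (connectedComponentIn {z | ∀ i, ℓ i z ≠ c i} x) ↔
      ∃ v ≠ 0, ∀ i, 0 ≤ (ℓ i x - c i) * ℓ i v := by
  simp only [connectedComponentIn_compl_hyperplanes hx,
    not_bounded_iff_exists_ne_zero_mem_asymptoticCone, mem_asymptoticCone_cell_iff hx]

end Hyperplanes

section PlaneGeometry

open Complex

attribute [local instance] Complex.finrank_real_complex_fact

/-- The planar cross product, that is, the signed area of the parallelogram spanned by two vectors
of `ℂ`. -/
noncomputable def cross : ℂ →L[ℝ] ℂ →L[ℝ] ℝ :=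
  Complex.orientation.areaForm'

theorem cross_apply (a b : ℂ) : cross a b = a.re * b.im - a.im * b.re := by
  simp [cross, sub_eq_add_neg]

theorem cross_self (a : ℂ) : cross a a = 0 :=
  Complex.orientation.areaForm_apply_self a

theorem cross_swap (a b : ℂ) : cross a b = -cross b a :=
  Complex.orientation.areaForm_swap a b

theorem cross_mul_right (a b c : ℂ) : cross (a * c) (b * c) = ‖c‖ ^ 2 * cross a b := by
  simp only [cross_apply, mul_re, mul_im, ← normSq_eq_norm_sq, normSq_apply]
  ring

theorem cross_eq_norm_mul_norm_mul_sin (a b : ℂ) :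
    cross a b = ‖a‖ * ‖b‖ * Real.sin (b.arg - a.arg) := by
  rw [cross_apply, Real.sin_sub, ← norm_mul_cos_arg a, ← norm_mul_sin_arg a, ← norm_mul_cos_arg b,
    ← norm_mul_sin_arg b]
  ring

theorem cross_eq_norm_sq_mul_im_div {a : ℂ} (ha : a ≠ 0) (b : ℂ) :
    cross a b = ‖a‖ ^ 2 * (b / a).im := by
  have h := cross_mul_right 1 (b / a) a
  rw [one_mul, div_mul_cancel₀ b ha] at h
  simpa [cross_apply] using h

theorem exists_eq_smul_of_cross_eq_zero {a b : ℂ} (ha : a ≠ 0) (h : cross a b = 0) :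
    ∃ r : ℝ, b = r • a := by
  have him : (b / a).im = 0 := by simpa [cross_eq_norm_sq_mul_im_div ha, ha] using h
  have hre : ((b / a).re : ℂ) = b / a := Complex.ext rfl him.symm
  exact ⟨(b / a).re, by rw [real_smul, hre, div_mul_cancel₀ b ha]⟩

theorem cross_sub_ne_zero_of_not_collinear {A B C : ℂ} (h : ¬ Collinear ℝ {A, B, C}) :
    cross (B - A) (C - A) ≠ 0 := by
  intro h0
  have hBA : B ≠ A := by rintro rfl; exact h (by simpa using collinear_pair ℝ B C)
  obtain ⟨r, hr⟩ := exists_eq_smul_of_cross_eq_zero (sub_ne_zero.2 hBA) h0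
  refine h ((collinear_iff_of_mem (p₀ := A) (by simp)).2 ⟨B - A, ?_⟩)
  rintro p (rfl | rfl | rfl)
  · exact ⟨0, by simp⟩
  · exact ⟨1, by simp⟩
  · exact ⟨r, by simp [← hr]⟩

/- Dividing by `v` puts the vectors in the closed upper half-plane, where the one of least argument
comes first. -/
theorem exists_forall_cross_nonneg {ι : Type*} [Finite ι] [Nonempty ι] {e : ι → ℂ} {v : ℂ}
    (hv : v ≠ 0) (h : ∀ i, 0 ≤ cross v (e i)) : ∃ i, ∀ j, 0 ≤ cross (e i) (e j) := by
  have hmul : ∀ k, e k = e k / v * v := fun k ↦ (div_mul_cancel₀ _ hv).symm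
  have him : ∀ k, 0 ≤ (e k / v).im := fun k ↦ by
    have hk := h k
    rw [cross_eq_norm_sq_mul_im_div hv] at hk
    exact nonneg_of_mul_nonneg_right hk (by positivity)
  obtain ⟨i, hi⟩ := Finite.exists_min fun i ↦ (e i / v).arg
  refine ⟨i, fun j ↦ ?_⟩
  rw [hmul i, hmul j, cross_mul_right, cross_eq_norm_mul_norm_mul_sin]
  have hsin : 0 ≤ Real.sin ((e j / v).arg - (e i / v).arg) :=
    Real.sin_nonneg_of_nonneg_of_le_pi (sub_nonneg.2 (hi j)) <| by
      linarith [arg_nonneg_iff.2 (him i), arg_le_pi (e j / v)]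
  positivity

theorem direction_ne_zero {P F : ℂ} (h : P ≠ F) (ε : ℝ) : direction P F ε ≠ 0 :=
  mul_ne_zero (exp_ne_zero _) (sub_ne_zero.2 h.symm)

theorem continuous_direction (P F : ℂ) : Continuous (direction P F) := by
  unfold direction
  fun_prop

theorem cross_sub_direction (P F : ℂ) (ε : ℝ) :
    cross (F - P) (direction P F ε) = ‖F - P‖ ^ 2 * Real.sin ε := by
  simp only [cross_apply, direction, mul_re, mul_im, exp_ofReal_mul_I_re, exp_ofReal_mul_I_im,
    ← normSq_eq_norm_sq, normSq_apply]
  ring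

theorem mem_lineOfRay_iff {P F : ℂ} (h : P ≠ F) {ε : ℝ} {z : ℂ} :
    z ∈ lineOfRay P F ε ↔ cross (direction P F ε) z = cross (direction P F ε) P := by
  rw [← sub_eq_zero, ← map_sub]
  constructor
  · rintro ⟨t, rfl⟩
    rw [add_sub_cancel_left, ← real_smul, map_smul, cross_self, smul_zero]
  · intro hz
    obtain ⟨r, hr⟩ := exists_eq_smul_of_cross_eq_zero (direction_ne_zero h ε) hz
    exact ⟨r, by rw [← real_smul, ← hr, add_sub_cancel]⟩

theorem mem_unboundedRegion_iff_not_isBounded {ι : Type*} {L : ι → Set ℂ} {z : ℂ} :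
    z ∈ unboundedRegion L ↔
      z ∈ (⋃ i, L i)ᶜ ∧ ¬ Bornology.IsBounded (connectedComponentIn (⋃ i, L i)ᶜ z) := by
  constructor
  · rintro ⟨_, ⟨x, -, rfl, hx⟩, hz⟩
    exact ⟨connectedComponentIn_subset _ _ hz, connectedComponentIn_eq hz ▸ hx⟩
  · rintro ⟨hz, hb⟩
    exact ⟨_, ⟨z, hz, rfl, hb⟩, mem_connectedComponentIn hz⟩

/-- The direction of the `i`-th line, scaled so that `F` lies on the same side of all the lines. -/
noncomputable def orientedDirection {ι : Type*} (P : ι → ℂ) (F : ℂ) (ε : ι → ℝ) (i : ι) : ℂ :=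
  Real.sin (ε i) • direction (P i) F (ε i)

section UnboundedRegion

variable {ι : Type*} {P : ι → ℂ} {F : ℂ}

theorem mem_unboundedRegion_lineOfRay_iff_exists_direction (hP : ∀ i, P i ≠ F) (ε : ι → ℝ) :
    F ∈ unboundedRegion (fun i ↦ lineOfRay (P i) F (ε i)) ↔
      (∀ i, Real.sin (ε i) ≠ 0) ∧ ∃ v ≠ 0, ∀ i, 0 ≤ cross v (orientedDirection P F ε i) := by
  have hcompl : (⋃ i, lineOfRay (P i) F (ε i))ᶜ = {z | ∀ i, cross (direction (P i) F (ε i)) z ≠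
      cross (direction (P i) F (ε i)) (P i)} := by
    ext z
    simp [mem_lineOfRay_iff (hP _)]
  have hnorm : ∀ i, 0 < ‖F - P i‖ ^ 2 := fun i ↦
    pow_pos (norm_pos_iff.2 (sub_ne_zero.2 (hP i).symm)) 2
  have hF : ∀ i, cross (direction (P i) F (ε i)) F - cross (direction (P i) F (ε i)) (P i) =
      -(‖F - P i‖ ^ 2 * Real.sin (ε i)) := fun i ↦ by
    rw [← map_sub, cross_swap, cross_sub_direction]
  have hside : ∀ i v, 0 ≤ -(‖F - P i‖ ^ 2 * Real.sin (ε i)) * cross (direction (P i) F (ε i)) v ↔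
      0 ≤ cross v (orientedDirection P F ε i) := fun i v ↦ by
    rw [← mul_nonneg_iff_of_pos_left (hnorm i) (b := cross v _), orientedDirection, map_smul,
      cross_swap v, smul_eq_mul]
    ring_nf
  rw [mem_unboundedRegion_iff_not_isBounded, hcompl]
  refine (and_congr_right fun hx ↦
    not_isBounded_connectedComponentIn_compl_hyperplanes_iff hx).trans ?_
  simp only [hF, hside, ← sub_ne_zero (b := cross _ (P _)), neg_ne_zero,
    mul_ne_zero_iff_left (hnorm _).ne']

theorem mem_unboundedRegion_lineOfRay_iff_exists_first [Finite ι] [Nonempty ι]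
    (hP : ∀ i, P i ≠ F) (ε : ι → ℝ) :
    F ∈ unboundedRegion (fun i ↦ lineOfRay (P i) F (ε i)) ↔ (∀ i, Real.sin (ε i) ≠ 0) ∧
      ∃ i, ∀ j, 0 ≤ cross (orientedDirection P F ε i) (orientedDirection P F ε j) := by
  rw [mem_unboundedRegion_lineOfRay_iff_exists_direction hP]
  refine and_congr_right fun hsin ↦ ⟨fun ⟨v, hv, h⟩ ↦ exists_forall_cross_nonneg hv h,
    fun ⟨i, hi⟩ ↦ ⟨_, smul_ne_zero (hsin i) (direction_ne_zero (hP i) _), hi⟩⟩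

theorem measurableSet_mem_unboundedRegion_lineOfRay {Ω : Type*} [MeasurableSpace Ω] [Finite ι]
    [Nonempty ι] (hP : ∀ i, P i ≠ F) {ε : ι → Ω → ℝ} (hε : ∀ i, Measurable (ε i)) :
    MeasurableSet {ω | F ∈ unboundedRegion fun i ↦ lineOfRay (P i) F (ε i ω)} := by
  have : Countable ι := Finite.to_countable
  have hsin : ∀ i, Measurable fun ω ↦ Real.sin (ε i ω) := fun i ↦ Real.measurable_sin.comp (hε i)
  have hdir : ∀ i, Measurable fun ω ↦ orientedDirection P F (fun k ↦ ε k ω) i := fun i ↦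
    (hsin i).smul ((continuous_direction _ _).measurable.comp (hε i))
  have hcross : Continuous fun p : ℂ × ℂ ↦ cross p.1 p.2 := by fun_prop
  simp only [mem_unboundedRegion_lineOfRay_iff_exists_first hP, Set.ofPred_and, Set.ofPred_exists,
    Set.ofPred_forall]
  exact (MeasurableSet.iInter fun i ↦ (hsin i (measurableSet_singleton 0)).compl).inter <|
    MeasurableSet.iUnion fun i ↦ MeasurableSet.iInter fun j ↦
      measurableSet_le measurable_const (hcross.measurable.comp ((hdir i).prodMk (hdir j)))

end UnboundedRegion

section MeetingRays

variable {P Q F : ℂ} {x y : ℝ}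

theorem exists_sub_eq_smul_sub_smul (h : (ray P F x ∩ ray Q F y).Nonempty) :
    ∃ t u : ℝ, 0 < t ∧ 0 < u ∧ P - Q = u • direction Q F y - t • direction P F x := by
  obtain ⟨z, ⟨t, ht, rfl⟩, u, hu, h⟩ := h
  exact ⟨t, u, ht, hu, by rw [real_smul, real_smul]; linear_combination h⟩

theorem sign_cross_direction_left_sub (h : (ray P F x ∩ ray Q F y).Nonempty) :
    SignType.sign (cross (direction P F x) (P - Q)) =
      SignType.sign (cross (direction P F x) (direction Q F y)) := by
  obtain ⟨t, u, -, hu, hPQ⟩ := exists_sub_eq_smul_sub_smul h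
  rw [hPQ, map_sub, map_smul, map_smul, cross_self, smul_zero, sub_zero, smul_eq_mul, sign_mul,
    sign_pos hu, one_mul]

theorem sign_cross_direction_right_sub (h : (ray P F x ∩ ray Q F y).Nonempty) :
    SignType.sign (cross (direction Q F y) (P - Q)) =
      SignType.sign (cross (direction P F x) (direction Q F y)) := by
  obtain ⟨t, u, ht, -, hPQ⟩ := exists_sub_eq_smul_sub_smul h
  rw [hPQ, map_sub, map_smul, map_smul, cross_self, smul_zero, zero_sub, ← smul_neg, ← cross_swap,
    smul_eq_mul, sign_mul, sign_pos ht, one_mul]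

/- The ray pointing away from `F` stays on the side of the line `QF` that contains `P`. -/
theorem sin_mul_cross_neg_of_ray_pi_inter (hcross : cross (P - F) (Q - F) ≠ 0)
    (h : (ray P F Real.pi ∩ ray Q F y).Nonempty) :
    Real.sin y * cross (Q - F) (P - F) < 0 := by
  obtain ⟨t, u, ht, hu, hPQ⟩ := exists_sub_eq_smul_sub_smul h
  have hpi : direction P F Real.pi = P - F := by simp [direction]
  have hdir : u • direction Q F y = (1 + t) • (P - F) + (F - Q) := by
    rw [hpi] at hPQ
    rw [add_smul, one_smul]
    linear_combination -hPQ
  have hkey : u * (‖F - Q‖ ^ 2 * Real.sin y) = (1 + t) * cross (P - F) (Q - F) := by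
    rw [← cross_sub_direction, ← smul_eq_mul, ← map_smul, hdir, map_add, map_smul, cross_self,
      cross_swap, ← map_neg, neg_sub, smul_eq_mul, add_zero]
  have hpos : 0 < u * ‖F - Q‖ ^ 2 * (Real.sin y * cross (P - F) (Q - F)) := by
    calc 0 < (1 + t) * cross (P - F) (Q - F) ^ 2 := by positivity
      _ = _ := by linear_combination -(cross (P - F) (Q - F)) * hkey
  rw [cross_swap (Q - F), mul_neg, neg_lt_zero]
  exact pos_of_mul_pos_right hpos (by positivity)

/- Expand `cross (F - P) (Q - P)` along the closed polygon from `P` to the meeting point and on to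
`Q`; when the rays lie on the line `PQ` only the contributions of the two angles remain. -/
theorem sin_mul_cross_neg_or_sin_mul_cross_neg_of_ray_inter (hcross : cross (P - F) (Q - F) ≠ 0)
    (h : (ray P F x ∩ ray Q F y).Nonempty) (hline : cross (direction Q F y) (P - Q) = 0) :
    Real.sin x * cross (P - F) (Q - F) < 0 ∨ Real.sin y * cross (Q - F) (P - F) < 0 := by
  rw [cross_swap (Q - F), mul_neg, neg_lt_zero]
  obtain ⟨t, u, ht, hu, hPQ⟩ := exists_sub_eq_smul_sub_smul h
  set κ := cross (P - F) (Q - F) with hκ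
  have hQ : cross (F - P) (direction Q F y) = ‖F - Q‖ ^ 2 * Real.sin y := by
    rw [← cross_sub_direction, ← sub_eq_zero, ← sub_apply, ← map_sub,
      sub_sub_sub_cancel_left, cross_swap, ← map_neg, neg_sub, hline]
  have hkey : -κ = t * (‖F - P‖ ^ 2 * Real.sin x) - u * (‖F - Q‖ ^ 2 * Real.sin y) := by
    calc -κ = cross (F - P) (Q - P) := by
          rw [hκ, ← sub_add_sub_cancel Q F P, map_add, cross_self, add_zero, ← neg_sub P F, map_neg,
            neg_apply]
      _ = _ := by
          rw [← neg_sub P Q, hPQ, neg_sub, map_sub, map_smul, map_smul, cross_sub_direction, hQ,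
            smul_eq_mul, smul_eq_mul]
  by_contra! hsign
  have hx : 0 ≤ t * ‖F - P‖ ^ 2 * (Real.sin x * κ) := mul_nonneg (by positivity) hsign.1
  have hy : u * ‖F - Q‖ ^ 2 * (Real.sin y * κ) ≤ 0 :=
    mul_nonpos_of_nonneg_of_nonpos (by positivity) hsign.2
  have hsq : 0 < κ ^ 2 := by positivity
  linarith [congrArg (κ * ·) hkey]

end MeetingRays

end PlaneGeometry

section Independence

variable {Ω : Type*} [MeasurableSpace Ω] {μ : Measure Ω}

theorem ae_mem_or_ae_mem_of_indepFun {α β : Type*} [MeasurableSpace α] [MeasurableSpace β]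
    {X : Ω → α} {Y : Ω → β} {A : Set α} {B : Set β} (h : IndepFun X Y μ) (hA : MeasurableSet A)
    (hB : MeasurableSet B) (hAB : ∀ᵐ ω ∂μ, X ω ∈ A ∨ Y ω ∈ B) :
    (∀ᵐ ω ∂μ, X ω ∈ A) ∨ ∀ᵐ ω ∂μ, Y ω ∈ B := by
  have hprod := h.measure_inter_preimage_eq_mul _ _ hA.compl hB.compl
  have hzero : μ (X ⁻¹' Aᶜ ∩ Y ⁻¹' Bᶜ) = 0 := by
    simp only [ae_iff, not_or] at hAB
    exact hAB
  exact mul_eq_zero.1 (hprod.symm.trans hzero)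

theorem exists_ae_eq_const_of_indepFun [NeZero μ] {α β γ : Type*} [MeasurableSpace α]
    [MeasurableSpace β] [Countable γ] {X : Ω → α} {Y : Ω → β} {f : α → γ} {g : β → γ}
    (h : IndepFun X Y μ) (hf : ∀ c, MeasurableSet (f ⁻¹' {c})) (hg : ∀ c, MeasurableSet (g ⁻¹' {c}))
    (hfg : ∀ᵐ ω ∂μ, f (X ω) = g (Y ω)) : ∃ c, ∀ᵐ ω ∂μ, f (X ω) = c := by
  by_contra hconst
  have hne : ∀ c, ∀ᵐ ω ∂μ, g (Y ω) ≠ c := fun c ↦ by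
    refine (ae_mem_or_ae_mem_of_indepFun h (hf c) (hg c).compl ?_).resolve_left
      fun hc ↦ hconst ⟨c, hc⟩
    filter_upwards [hfg] with ω hω
    by_cases hc : f (X ω) = c
    · exact .inl hc
    · exact .inr fun hc' ↦ hc (hω.trans hc')
  obtain ⟨ω, hω⟩ := (ae_all_iff.2 hne).exists
  exact hω _ rfl

theorem measure_setOf_mem_of_iIndepFun {ι α : Type*} [Fintype ι] [Finite α] [MeasurableSpace α]
    [MeasurableSingletonClass α] {b : ι → Ω → α} (hb : ∀ i, Measurable (b i))
    (hindep : iIndepFun b μ) {p : ENNReal} (hp : ∀ i a, μ (b i ⁻¹' {a}) = p) (T : Set (ι → α)) :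
    μ {ω | (fun i ↦ b i ω) ∈ T} = T.ncard * p ^ Fintype.card ι := by
  have hprob : IsProbabilityMeasure μ := hindep.isProbabilityMeasure
  have hsingle : ∀ σ, μ.map (fun ω i ↦ b i ω) {σ} = p ^ Fintype.card ι := fun σ ↦ by
    have : ∀ i, IsProbabilityMeasure (μ.map (b i)) := fun i ↦
      Measure.isProbabilityMeasure_map (hb i).aemeasurable
    rw [hindep.map_fun_eq_pi_map fun i ↦ (hb i).aemeasurable, Measure.pi_singleton]
    simp [Measure.map_apply (hb _) (measurableSet_singleton _), hp]
  calc μ {ω | (fun i ↦ b i ω) ∈ T} = μ.map (fun ω i ↦ b i ω) T :=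
        (Measure.map_apply (measurable_pi_lambda _ hb) T.toFinite.measurableSet).symm
    _ = ∑ σ ∈ T.toFinite.toFinset, μ.map (fun ω i ↦ b i ω) {σ} := by
        rw [sum_measure_singleton, Set.Finite.coe_toFinset]
    _ = T.ncard * p ^ Fintype.card ι := by
        simp [hsingle, Set.ncard_eq_toFinset_card T]

end Independence

section RandomAngles

variable {Ω : Type*} [MeasurableSpace Ω] {μ : Measure Ω} {X Y : Ω → ℝ} {P Q F : ℂ}

theorem not_ae_sin_mul_neg (hrange : ∀ ω, X ω ∈ Set.Ioc (-Real.pi) Real.pi)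
    (hneg : μ {ω | X ω < 0} ≠ 0) (hpos : μ {ω | 0 < X ω} ≠ 0) (κ : ℝ) :
    ¬ ∀ᵐ ω ∂μ, Real.sin (X ω) * κ < 0 := by
  simp only [not_eventually, not_lt]
  obtain hκ | hκ := le_total 0 κ
  · exact (frequently_ae_iff.2 hpos).mono fun ω hω ↦
      mul_nonneg (Real.sin_nonneg_of_nonneg_of_le_pi hω.le (hrange ω).2) hκ
  · exact (frequently_ae_iff.2 hneg).mono fun ω hω ↦ mul_nonneg_of_nonpos_of_nonpos
      (Real.sin_nonpos_of_nonpos_of_neg_pi_le hω.le (hrange ω).1.le) hκ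

theorem ae_ne_pi_of_ae_nonempty_inter (hindep : IndepFun X Y μ)
    (hY : ∀ κ : ℝ, ¬ ∀ᵐ ω ∂μ, Real.sin (Y ω) * κ < 0) (hcross : cross (P - F) (Q - F) ≠ 0)
    (hinter : ∀ᵐ ω ∂μ, (ray P F (X ω) ∩ ray Q F (Y ω)).Nonempty) :
    ∀ᵐ ω ∂μ, X ω ≠ Real.pi := by
  refine (ae_mem_or_ae_mem_of_indepFun hindep (measurableSet_singleton _).compl
    (B := {y | Real.sin y * cross (Q - F) (P - F) < 0})
    (measurableSet_lt (by fun_prop) measurable_const) ?_).resolve_right (hY _)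
  filter_upwards [hinter] with ω hω
  by_cases hX : X ω = Real.pi
  · exact .inr (sin_mul_cross_neg_of_ray_pi_inter hcross (hX ▸ hω))
  · exact .inl hX

theorem measurableSet_setOf_sign_eq {α : Type*} [MeasurableSpace α] {f : α → ℝ}
    (hf : Measurable f) (s : SignType) : MeasurableSet {a | SignType.sign (f a) = s} := by
  match s with
  | 0 => simpa only [sign_eq_zero_iff] using measurableSet_eq_fun hf measurable_const
  | 1 => simpa only [sign_eq_one_iff] using measurableSet_lt measurable_const hf
  | -1 => simpa only [sign_eq_neg_one_iff] using measurableSet_lt hf measurable_const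

/- When the rays meet, the sign of their cross product is a function of each of the two angles
separately, so independence makes it constant. -/
theorem ae_cross_direction_pos_or_ae_cross_direction_swap_pos [NeZero μ] (hindep : IndepFun X Y μ)
    (hX : ∀ κ : ℝ, ¬ ∀ᵐ ω ∂μ, Real.sin (X ω) * κ < 0)
    (hY : ∀ κ : ℝ, ¬ ∀ᵐ ω ∂μ, Real.sin (Y ω) * κ < 0) (hcross : cross (P - F) (Q - F) ≠ 0)
    (hinter : ∀ᵐ ω ∂μ, (ray P F (X ω) ∩ ray Q F (Y ω)).Nonempty) :
    (∀ᵐ ω ∂μ, 0 < cross (direction P F (X ω)) (direction Q F (Y ω))) ∨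
      ∀ᵐ ω ∂μ, 0 < cross (direction Q F (Y ω)) (direction P F (X ω)) := by
  have hmeas : ∀ P v s, MeasurableSet {x | SignType.sign (cross (direction P F x) v) = s} :=
    fun P v s ↦ measurableSet_setOf_sign_eq
      ((cross.flip v).continuous.comp (continuous_direction P F)).measurable s
  obtain ⟨s, hs⟩ := exists_ae_eq_const_of_indepFun hindep (hmeas P (P - Q)) (hmeas Q (P - Q))
    (hinter.mono fun ω hω ↦
      (sign_cross_direction_left_sub hω).trans (sign_cross_direction_right_sub hω).symm)
  have hsign : ∀ᵐ ω ∂μ,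
      SignType.sign (cross (direction P F (X ω)) (direction Q F (Y ω))) = s := by
    filter_upwards [hinter, hs] with ω hω hsω
    exact (sign_cross_direction_left_sub hω).symm.trans hsω
  match s with
  | 1 => exact .inl (hsign.mono fun ω ↦ sign_eq_one_iff.1)
  | -1 =>
    refine .inr (hsign.mono fun ω hω ↦ ?_)
    rwa [cross_swap, neg_pos, ← sign_eq_neg_one_iff]
  | 0 =>
    have hside : (∀ᵐ ω ∂μ, Real.sin (X ω) * cross (P - F) (Q - F) < 0) ∨
        ∀ᵐ ω ∂μ, Real.sin (Y ω) * cross (Q - F) (P - F) < 0 := by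
      refine ae_mem_or_ae_mem_of_indepFun hindep
        (A := {x | Real.sin x * cross (P - F) (Q - F) < 0})
        (B := {y | Real.sin y * cross (Q - F) (P - F) < 0})
        (measurableSet_lt (by fun_prop) measurable_const)
        (measurableSet_lt (by fun_prop) measurable_const) ?_
      filter_upwards [hinter, hsign] with ω hω h0
      refine sin_mul_cross_neg_or_sin_mul_cross_neg_of_ray_inter hcross hω (sign_eq_zero_iff.1 ?_)
      rw [sign_cross_direction_right_sub hω, h0]
    exact (hside.elim (hX _) (hY _)).elim

end RandomAngles

section Leader

variable {ι : Type*} {r : ι → ι → Prop} {σ : ι → Bool} {i j : ι}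

/-- `i` precedes every other element once the relation `r` is reversed between the elements that
carry different signs `σ`. -/
def IsLeader (r : ι → ι → Prop) (σ : ι → Bool) (i : ι) : Prop :=
  ∀ j, j ≠ i → (σ j = σ i ↔ r i j)

theorem IsLeader.eq (hr : ∀ i j, i ≠ j → (r i j ↔ ¬ r j i)) (hi : IsLeader r σ i)
    (hj : IsLeader r σ j) : i = j := by
  by_contra hij
  have hji : r j i ↔ r i j := (hj i hij).symm.trans (eq_comm.trans (hi j (Ne.symm hij)))
  exact (iff_not_self (hji.trans (hr i j hij))).elim

open Classical in
/-- The assignment of signs for which `i` is the leader of `r` and has sign `c`. -/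
noncomputable def leaderSigns (r : ι → ι → Prop) (i : ι) (c : Bool) (j : ι) : Bool :=
  if j = i ∨ r i j then c else !c

theorem leaderSigns_self (r : ι → ι → Prop) (i : ι) (c : Bool) : leaderSigns r i c i = c := by
  simp [leaderSigns]

theorem isLeader_iff_exists_leaderSigns_eq :
    IsLeader r σ i ↔ ∃ c, leaderSigns r i c = σ := by
  constructor
  · refine fun h ↦ ⟨σ i, funext fun j ↦ ?_⟩
    by_cases hj : j = i
    · rw [hj, leaderSigns_self]
    · by_cases hij : r i j
      · simp [leaderSigns, hij, (h j hj).2 hij]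
      · simp [leaderSigns, hj, hij, Bool.eq_not.2 fun hσ ↦ hij ((h j hj).1 hσ)]
  · rintro ⟨c, rfl⟩ j hj
    by_cases hij : r i j <;> simp [leaderSigns, hj, hij]

theorem ncard_exists_isLeader [Fintype ι] (hr : ∀ i j, i ≠ j → (r i j ↔ ¬ r j i)) :
    {σ | ∃ i, IsLeader r σ i}.ncard = 2 * Fintype.card ι := by
  have hrange : {σ | ∃ i, IsLeader r σ i} = Set.range fun p : ι × Bool ↦ leaderSigns r p.1 p.2 := by
    ext σ
    simp [isLeader_iff_exists_leaderSigns_eq]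
  have hinj : Function.Injective fun p : ι × Bool ↦ leaderSigns r p.1 p.2 := by
    rintro ⟨i, c⟩ ⟨j, d⟩ h
    obtain rfl : i = j := IsLeader.eq hr (isLeader_iff_exists_leaderSigns_eq.2 ⟨c, h⟩)
      (isLeader_iff_exists_leaderSigns_eq.2 ⟨d, rfl⟩)
    simpa [leaderSigns_self] using congrFun h i
  rw [hrange, ← Set.image_univ, Set.ncard_image_of_injective _ hinj, Set.ncard_univ]
  simp [mul_comm]

end Leader

theorem sign_sin_of_mem_Ioo {x : ℝ} (hx : x ∈ Set.Ioo (-Real.pi) Real.pi) :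
    SignType.sign (Real.sin x) = SignType.sign x := by
  obtain hneg | rfl | hpos := lt_trichotomy x 0
  · rw [sign_neg hneg, sign_neg (Real.sin_neg_of_neg_of_neg_pi_lt hneg hx.1)]
  · rw [Real.sin_zero]
  · rw [sign_pos hpos, sign_pos (Real.sin_pos_of_pos_of_lt_pi hpos hx.2)]

theorem mul_pos_iff_pos_iff_pos {R : Type*} [Ring R] [LinearOrder R] [IsStrictOrderedRing R]
    {a b : R} (ha : a ≠ 0) (hb : b ≠ 0) : 0 < a * b ↔ (0 < a ↔ 0 < b) := by
  rcases ha.lt_or_gt with ha | ha <;> rcases hb.lt_or_gt with hb | hb <;>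
    simp [mul_pos_iff, ha, hb, ha.not_gt, hb.not_gt]

theorem mem_unboundedRegion_lineOfRay_iff_exists_isLeader {ι : Type*} [Finite ι] [Nonempty ι]
    {P : ι → ℂ} {F : ℂ} {r : ι → ι → Prop} (hP : ∀ i, P i ≠ F) {ε : ι → ℝ}
    (hε : ∀ i, ε i ∈ Set.Ioo (-Real.pi) Real.pi) (hε0 : ∀ i, ε i ≠ 0)
    (hcross : ∀ i j, i ≠ j → cross (direction (P i) F (ε i)) (direction (P j) F (ε j)) ≠ 0)
    (hr : ∀ i j, i ≠ j →
      (0 < cross (direction (P i) F (ε i)) (direction (P j) F (ε j)) ↔ r i j)) :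
    F ∈ unboundedRegion (fun i ↦ lineOfRay (P i) F (ε i)) ↔
      ∃ i, IsLeader r (fun j ↦ decide (0 < ε j)) i := by
  have hsin : ∀ i, Real.sin (ε i) ≠ 0 := fun i ↦ by
    rw [← sign_ne_zero, sign_sin_of_mem_Ioo (hε i), sign_ne_zero]
    exact hε0 i
  have hsin_pos : ∀ i, 0 < Real.sin (ε i) ↔ 0 < ε i := fun i ↦ by
    rw [← sign_eq_one_iff, sign_sin_of_mem_Ioo (hε i), sign_eq_one_iff]
  rw [mem_unboundedRegion_lineOfRay_iff_exists_first hP, and_iff_right hsin]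
  refine exists_congr fun i ↦ forall_congr' fun j ↦ ?_
  obtain rfl | hij := eq_or_ne i j
  · simp [cross_self]
  · have hc := hcross i j hij
    rw [orientedDirection, orientedDirection, map_smul, map_smul, smul_apply, smul_eq_mul,
      smul_eq_mul, (mul_ne_zero (hsin j) (mul_ne_zero (hsin i) hc)).symm.le_iff_lt,
      mul_pos_iff_pos_iff_pos (hsin j) (mul_ne_zero (hsin i) hc),
      mul_pos_iff_pos_iff_pos (hsin i) hc, hsin_pos, hsin_pos, hr i j hij, ← iff_assoc,
      decide_eq_decide, forall_prop_of_true hij.symm]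

section RandomRays

variable {ι Ω : Type*} [MeasurableSpace Ω] {μ : Measure Ω} {P : ι → ℂ} {F : ℂ} {ε : ι → Ω → ℝ}
  {i j : ι}

/-- The relation between the indices of random rays that ray `j` almost surely turns
counterclockwise from ray `i`. -/
def AEPrecedes (μ : Measure Ω) (P : ι → ℂ) (F : ℂ) (ε : ι → Ω → ℝ) (i j : ι) : Prop :=
  ∀ᵐ ω ∂μ, 0 < cross (direction (P i) F (ε i ω)) (direction (P j) F (ε j ω))

theorem aePrecedes_iff_not_aePrecedes_swap [NeZero μ]
    (h : AEPrecedes μ P F ε i j ∨ AEPrecedes μ P F ε j i) :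
    AEPrecedes μ P F ε i j ↔ ¬ AEPrecedes μ P F ε j i := by
  refine ⟨fun hij hji ↦ ?_, h.resolve_right⟩
  obtain ⟨ω, hω, hω'⟩ := (hij.and hji).exists
  rw [cross_swap, neg_pos] at hω'
  exact hω.asymm hω'

theorem ae_cross_direction_ne_zero_and_pos_iff
    (h : AEPrecedes μ P F ε i j ∨ AEPrecedes μ P F ε j i) :
    ∀ᵐ ω ∂μ, cross (direction (P i) F (ε i ω)) (direction (P j) F (ε j ω)) ≠ 0 ∧
      (0 < cross (direction (P i) F (ε i ω)) (direction (P j) F (ε j ω)) ↔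
        AEPrecedes μ P F ε i j) := by
  by_cases hij : AEPrecedes μ P F ε i j
  · filter_upwards [hij] with ω hω using ⟨hω.ne', iff_of_true hω hij⟩
  · filter_upwards [h.resolve_left hij] with ω hω
    rw [cross_swap, neg_ne_zero, neg_pos]
    exact ⟨hω.ne', iff_of_false hω.asymm hij⟩

theorem ae_mem_unboundedRegion_lineOfRay_iff [Finite ι] [Nonempty ι]
    (hP : ∀ i, P i ≠ F) (hε : ∀ i, ∀ᵐ ω ∂μ, ε i ω ∈ Set.Ioo (-Real.pi) Real.pi)
    (hε0 : ∀ i, ∀ᵐ ω ∂μ, ε i ω ≠ 0)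
    (hprec : ∀ i j, i ≠ j → AEPrecedes μ P F ε i j ∨ AEPrecedes μ P F ε j i) :
    ∀ᵐ ω ∂μ, F ∈ unboundedRegion (fun i ↦ lineOfRay (P i) F (ε i ω)) ↔
      ∃ i, IsLeader (AEPrecedes μ P F ε) (fun j ↦ decide (0 < ε j ω)) i := by
  have : Countable ι := Finite.to_countable
  have hcross := ae_all_iff.2 fun i ↦ ae_all_iff.2 fun j ↦ eventually_all.2 fun hij : i ≠ j ↦
    ae_cross_direction_ne_zero_and_pos_iff (hprec i j hij)
  filter_upwards [ae_all_iff.2 hε, ae_all_iff.2 hε0, hcross] with ω hω hω0 hc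
  exact mem_unboundedRegion_lineOfRay_iff_exists_isLeader hP hω hω0
    (fun i j hij ↦ (hc i j hij).1) fun i j hij ↦ (hc i j hij).2

end RandomRays

section FairSigns

variable {Ω : Type*} [MeasurableSpace Ω] {μ : Measure Ω} [IsProbabilityMeasure μ] {X : Ω → ℝ}

theorem ae_ne_zero_of_measure_eq_half (hX : Measurable X) (hneg : μ {ω | X ω < 0} = 1 / 2)
    (hpos : μ {ω | 0 < X ω} = 1 / 2) : ∀ᵐ ω ∂μ, X ω ≠ 0 := by
  have hmeas : MeasurableSet {ω | 0 < X ω} := measurableSet_lt measurable_const hX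
  have hdisj : Disjoint {ω | X ω < 0} {ω | 0 < X ω} :=
    Set.disjoint_left.2 fun ω (h : X ω < 0) ↦ h.not_gt
  have hone : μ ({ω | X ω < 0} ∪ {ω | 0 < X ω}) = 1 := by
    rw [measure_union hdisj hmeas, hneg, hpos, ENNReal.add_halves]
  have hae : ∀ᵐ ω ∂μ, X ω < 0 ∨ 0 < X ω :=
    (mem_ae_iff_prob_eq_one ((measurableSet_lt hX measurable_const).union hmeas)).2 hone
  exact hae.mono fun ω ↦ ne_iff_lt_or_gt.2

theorem measurable_decide_pos : Measurable fun x : ℝ ↦ decide (0 < x) := by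
  have hpreimage : (fun x : ℝ ↦ decide (0 < x)) ⁻¹' {true} = Set.Ioi 0 := by ext; simp
  exact measurable_to_bool (hpreimage ▸ measurableSet_Ioi)

theorem measure_preimage_decide_pos (hX : Measurable X) (hpos : μ {ω | 0 < X ω} = 1 / 2)
    (c : Bool) : μ ((fun ω ↦ decide (0 < X ω)) ⁻¹' {c}) = 1 / 2 := by
  have htrue : (fun ω ↦ decide (0 < X ω)) ⁻¹' {true} = {ω | 0 < X ω} := by ext; simp
  have hfalse : (fun ω ↦ decide (0 < X ω)) ⁻¹' {false} = {ω | 0 < X ω}ᶜ := by ext; simp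
  cases c
  · rw [hfalse, prob_compl_eq_one_sub (measurableSet_lt measurable_const hX), hpos, one_div,
      ENNReal.one_sub_inv_two]
  · rw [htrue, hpos]

theorem measure_exists_isLeader {ι : Type*} [Fintype ι] {ε : ι → Ω → ℝ} {r : ι → ι → Prop}
    (hr : ∀ i j, i ≠ j → (r i j ↔ ¬ r j i)) (hmeas : ∀ i, Measurable (ε i))
    (hindep : iIndepFun ε μ) (hpos : ∀ i, μ {ω | 0 < ε i ω} = 1 / 2) :
    μ {ω | ∃ i, IsLeader r (fun j ↦ decide (0 < ε j ω)) i} =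
      (2 * Fintype.card ι) / 2 ^ Fintype.card ι := by
  have hcount := measure_setOf_mem_of_iIndepFun
    (fun i ↦ measurable_decide_pos.comp (hmeas i)) (hindep.comp _ fun _ ↦ measurable_decide_pos)
    (fun i ↦ measure_preimage_decide_pos (hmeas i) (hpos i)) {σ | ∃ i, IsLeader r σ i}
  rw [ncard_exists_isLeader hr, one_div, ← ENNReal.inv_pow, ← div_eq_mul_inv] at hcount
  exact_mod_cast hcount

end FairSigns

end CockedHat

open CockedHat in
theorem mainTheorem2_general {ι Ω : Type*} [Fintype ι] [Nontrivial ι] [MeasurableSpace Ω]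
    (μ : Measure Ω) (P : ι → ℂ) (F : ℂ) (hgen : ∀ i j, i ≠ j → ¬ Collinear ℝ {F, P i, P j})
    (ε : ι → Ω → ℝ) (hmeas : ∀ i, Measurable (ε i))
    (hrange : ∀ i ω, ε i ω ∈ Set.Ioc (-Real.pi) Real.pi) (hindep : iIndepFun ε μ)
    (hneg : ∀ i, μ {ω | ε i ω < 0} = 1 / 2) (hpos : ∀ i, μ {ω | 0 < ε i ω} = 1 / 2)
    (hinter : ∀ i j, i ≠ j → μ {ω | ray (P i) F (ε i ω) ∩ ray (P j) F (ε j ω) = ∅} = 0) :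
    MeasurableSet {ω | F ∈ unboundedRegion fun i ↦ lineOfRay (P i) F (ε i ω)} ∧
      μ {ω | F ∈ unboundedRegion fun i ↦ lineOfRay (P i) F (ε i ω)} =
        (2 * Fintype.card ι) / 2 ^ Fintype.card ι := by
  have hprob : IsProbabilityMeasure μ := hindep.isProbabilityMeasure
  have hP : ∀ i, P i ≠ F := fun i h ↦ by
    obtain ⟨j, hj⟩ := exists_ne i
    exact hgen i j hj.symm (by simpa [h] using collinear_pair ℝ F (P j))
  have hcross : ∀ i j, i ≠ j → cross (P i - F) (P j - F) ≠ 0 := fun i j hij ↦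
    cross_sub_ne_zero_of_not_collinear (hgen i j hij)
  have hmeet : ∀ i j, i ≠ j →
      ∀ᵐ ω ∂μ, (ray (P i) F (ε i ω) ∩ ray (P j) F (ε j ω)).Nonempty := fun i j hij ↦
    ae_iff.2 (by simpa only [Set.not_nonempty_iff_eq_empty] using hinter i j hij)
  have hside : ∀ i κ, ¬ ∀ᵐ ω ∂μ, Real.sin (ε i ω) * κ < 0 := fun i ↦
    not_ae_sin_mul_neg (hrange i) (by simp [hneg]) (by simp [hpos])
  have hε : ∀ i, ∀ᵐ ω ∂μ, ε i ω ∈ Set.Ioo (-Real.pi) Real.pi := fun i ↦ by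
    obtain ⟨j, hj⟩ := exists_ne i
    filter_upwards [ae_ne_pi_of_ae_nonempty_inter (hindep.indepFun hj.symm) (hside j)
      (hcross i j hj.symm) (hmeet i j hj.symm)] with ω hω
    exact ⟨(hrange i ω).1, (hrange i ω).2.lt_of_ne hω⟩
  have hprec : ∀ i j, i ≠ j → AEPrecedes μ P F ε i j ∨ AEPrecedes μ P F ε j i := fun i j hij ↦
    ae_cross_direction_pos_or_ae_cross_direction_swap_pos (hindep.indepFun hij) (hside i) (hside j)
      (hcross i j hij) (hmeet i j hij)
  have hleader := ae_mem_unboundedRegion_lineOfRay_iff hP hε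
    (fun i ↦ ae_ne_zero_of_measure_eq_half (hmeas i) (hneg i) (hpos i)) hprec
  refine ⟨measurableSet_mem_unboundedRegion_lineOfRay hP hmeas, ?_⟩
  exact (measure_congr (eventuallyEq_set.2 hleader)).trans <| measure_exists_isLeader
    (fun i j hij ↦ aePrecedes_iff_not_aePrecedes_swap (hprec i j hij)) hmeas hindep hpos

theorem mainTheorem2 {Ω : Type*} [MeasurableSpace Ω]
    (μ : MeasureTheory.Measure Ω) [MeasureTheory.IsProbabilityMeasure μ]
    (n : ℕ) (hn : 3 ≤ n) (P : Fin n → ℂ) (F : ℂ)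
    (hgen : CockedHat.GeneralPosition (Fin.cons F P : Fin (n + 1) → ℂ))
    (ε : Fin n → Ω → ℝ) (hmeas : ∀ i, Measurable (ε i))
    (hrange : ∀ i ω, ε i ω ∈ Set.Ioc (-Real.pi) Real.pi)
    (hindep : ProbabilityTheory.iIndepFun ε μ)
    (hneg : ∀ i, μ {ω | ε i ω < 0} = 1 / 2)
    (hpos : ∀ i, μ {ω | 0 < ε i ω} = 1 / 2)
    (hinter : ∀ i j, i ≠ j →
      μ {ω | CockedHat.ray (P i) F (ε i ω) ∩ CockedHat.ray (P j) F (ε j ω) = ∅} = 0) :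
    MeasurableSet
        {ω | F ∈ CockedHat.unboundedRegion fun i => CockedHat.lineOfRay (P i) F (ε i ω)} ∧
      μ {ω | F ∈ CockedHat.unboundedRegion fun i => CockedHat.lineOfRay (P i) F (ε i ω)} =
        (2 * n) / 2 ^ n := by
  have : Nontrivial (Fin n) := Fin.nontrivial_iff_two_le.2 (by omega)
  have hcol : ∀ i j, i ≠ j → ¬ Collinear ℝ {F, P i, P j} := fun i j hij ↦
    hgen 0 i.succ j.succ (Fin.succ_ne_zero i).symm (Fin.succ_ne_zero j).symm (by simpa using hij)
  simpa using mainTheorem2_general μ P F hcol ε hmeas hrange hindep hneg hpos hinter
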